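/- Let $H$ be a separable complex Hilbert space. Given an orthonormal basis $(e_n)_{n\in\mathbb N}$ of $H$ and infinite sets $P=\{p_1<p_2<\cdots\}$ and $Q=\{q_1<q_2<\cdots\}$ of natural numbers, the spread $S_{P,Q}$ (with respect to this basis) is the bounded operator with $S_{P,Q}e_{p_k}=e_{q_k}$ for all $k$ and $S_{P,Q}e_n=0$ for $n\notin P$. A unitary operator $U$ on $H$ is called a unitary spread if there are an orthonormal basis $(e_n)_{n\in\mathbb N}$ of $H$ and a sequence of spreads $S_{P_n,Q_n}$ with respect to it such that $\sum_{n=1}^\infty S_{P_n,Q_n}$ converges to $U$ in the strong operator topology. A ring is a set of the form $\{\lambda\in\mathbb C: a<|\lambda|<b\}$ with $0<a<b<\infty$, where each of the two inequalities $a<|\lambda|$, $|\lambda|<b$ may be replaced by the non-strict one. Write $\sigma(T)$ and $\sigma_p(T)$ for the spectrum and the set of eigenvalues of a bounded operator $T$. Theorem. Let $0<\lambda_1<\lambda_2$ and let $A$ be a bounded self-adjoint operator on $H$ with $\sigma(A)=[\lambda_1,\lambda_2]$ and $\sigma_p(A)=\varnothing$. Then for every ring $R\subseteq\{\lambda\in\mathbb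 C:\lambda_1<|\lambda|<\lambda_2\}$ there exists a unitary spread $U$ on $H$ such that $\sigma_p(UA)=R$. -/

import Mathlib

open Filter Topology

section UnitarySpread

variable {H : Type*} [NormedAddCommGroup H] [InnerProductSpace ℂ H]

/-- The point spectrum `σ_p(T)`: the set of eigenvalues of the bounded operator `T`. -/
def pointSpectrum (T : H →L[ℂ] H) : Set ℂ :=
  {μ | Module.End.HasEigenvalue (T : H →ₗ[ℂ] H) μ}

/-- The increasing enumeration `a₀ < a₁ < ⋯` of an infinite set `A ⊆ ℕ` picks out an orthonormal
subsequence `e_{a₀}, e_{a₁}, …` of an orthonormal basis `e`. -/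
theorem orthonormal_subsequence (e : HilbertBasis ℕ ℂ H) {A : Set ℕ} (hA : A.Infinite) :
    Orthonormal ℂ (fun k : ℕ => e (Nat.nth (· ∈ A) k)) :=
  e.orthonormal.comp _ (Nat.nth_injective hA)

variable [CompleteSpace H]

/-- The isometry `ℓ² → H` sending the `k`-th unit vector to `e_{a_k}`, where `a₀ < a₁ < ⋯` is the
increasing enumeration of the infinite set `A`. -/
noncomputable def subsequenceIsometry (e : HilbertBasis ℕ ℂ H) {A : Set ℕ} (hA : A.Infinite) :
    lp (fun _ : ℕ => ℂ) 2 →ₗᵢ[ℂ] H :=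
  (orthonormal_subsequence e hA).orthogonalFamily.linearIsometry

/-- The spread `S_{A,B}` from `A` to `B` (infinite subsets of `ℕ` with increasing enumerations
`a₀ < a₁ < ⋯` and `b₀ < b₁ < ⋯`) with respect to the orthonormal basis `e`: the bounded operator
with `S e_{a_k} = e_{b_k}` for all `k` and `S e_n = 0` for `n ∉ A`; see `spread_apply_nth` and
`spread_apply_of_notMem`. -/
noncomputable def spread (e : HilbertBasis ℕ ℂ H) {A B : Set ℕ} (hA : A.Infinite)
    (hB : B.Infinite) : H →L[ℂ] H :=
  (subsequenceIsometry e hB).toContinuousLinearMap ∘L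
    ContinuousLinearMap.adjoint (subsequenceIsometry e hA).toContinuousLinearMap

theorem subsequenceIsometry_single (e : HilbertBasis ℕ ℂ H) {A : Set ℕ} (hA : A.Infinite) (k : ℕ) :
    subsequenceIsometry e hA (lp.single 2 k (1 : ℂ)) = e (Nat.nth (· ∈ A) k) := by
  simp [subsequenceIsometry, OrthogonalFamily.linearIsometry_apply_single]

theorem adjoint_subsequenceIsometry_apply (e : HilbertBasis ℕ ℂ H) {A : Set ℕ} (hA : A.Infinite)
    (y : H) (k : ℕ) :
    ContinuousLinearMap.adjoint (subsequenceIsometry e hA).toContinuousLinearMap y k =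
      inner ℂ (e (Nat.nth (· ∈ A) k)) y := by
  have h := lp.inner_single_left (𝕜 := ℂ) k (1 : ℂ)
    (ContinuousLinearMap.adjoint (subsequenceIsometry e hA).toContinuousLinearMap y)
  rw [ContinuousLinearMap.adjoint_inner_right] at h
  simpa [subsequenceIsometry_single] using h.symm

theorem spread_apply_nth (e : HilbertBasis ℕ ℂ H) {A B : Set ℕ} (hA : A.Infinite)
    (hB : B.Infinite) (k : ℕ) :
    spread e hA hB (e (Nat.nth (· ∈ A) k)) = e (Nat.nth (· ∈ B) k) := by
  have h : ContinuousLinearMap.adjoint (subsequenceIsometry e hA).toContinuousLinearMap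
      (e (Nat.nth (· ∈ A) k)) = lp.single 2 k (1 : ℂ) := by
    ext j
    rw [adjoint_subsequenceIsometry_apply,
      orthonormal_iff_ite.mp (orthonormal_subsequence e hA) j k]
    simp [lp.single_apply, Pi.single_apply]
  simp [spread, h, subsequenceIsometry_single]

theorem spread_apply_of_notMem (e : HilbertBasis ℕ ℂ H) {A B : Set ℕ} (hA : A.Infinite)
    (hB : B.Infinite) {n : ℕ} (hn : n ∉ A) : spread e hA hB (e n) = 0 := by
  have h : ContinuousLinearMap.adjoint (subsequenceIsometry e hA).toContinuousLinearMap
      (e n) = 0 := by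
    ext j
    rw [adjoint_subsequenceIsometry_apply, orthonormal_iff_ite.mp e.orthonormal,
      if_neg fun hj : Nat.nth (· ∈ A) j = n => hn (hj ▸ Nat.nth_mem_of_infinite hA j)]
    rfl
  simp [spread, h]

/-- A unitary operator `U` is a unitary spread if, for some orthonormal basis `(e_n)` of `H`, it is
the limit in the strong operator topology of a series of spreads `∑ S_{A_n,B_n}` (with respect to
that basis). -/
def IsUnitarySpread (U : H →L[ℂ] H) : Prop :=
  U ∈ unitary (H →L[ℂ] H) ∧
    ∃ (e : HilbertBasis ℕ ℂ H) (A B : ℕ → Set ℕ) (hA : ∀ n, (A n).Infinite)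
      (hB : ∀ n, (B n).Infinite),
      ∀ x : H, Tendsto (fun N : ℕ => ∑ n ∈ Finset.range N, spread e (hA n) (hB n) x)
        atTop (𝓝 (U x))

end UnitarySpread

/-- A ring: an annulus centred at the origin with radii `0 < a < b`, where each of the two boundary
circles may or may not be included. -/
def IsAnnularRing (R : Set ℂ) : Prop :=
  ∃ a b : ℝ, 0 < a ∧ a < b ∧
    (R = {z : ℂ | a < ‖z‖ ∧ ‖z‖ < b} ∨ R = {z : ℂ | a ≤ ‖z‖ ∧ ‖z‖ ≤ b} ∨
      R = {z : ℂ | a ≤ ‖z‖ ∧ ‖z‖ < b} ∨ R = {z : ℂ | a < ‖z‖ ∧ ‖z‖ ≤ b})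

/-!
Choose disjoint windows `[p n, q n]`, `n ∈ ℤ`, in `σ(A)` which shrink to the inner radius `a` of `R`
as `n → ∞` and to the outer radius `b` as `n → -∞`, and let `K n` be the spectral subspace of `A`
for the `n`-th window, `K 0` being enlarged so that `H` is the orthogonal sum of the `K n`. All the
`K n` are infinite-dimensional, so orthonormal bases of them yield a unitary spread `U` carrying
each `K n` onto `K (n + 1)`. Then `U A` is a bilateral shift with operator weights, and the
components `x n ∈ K n` of a solution of `U A x = μ x` satisfy
`p n * ‖x n‖ ≤ |μ| * ‖x (n + 1)‖ ≤ q n * ‖x n‖` for `n ≠ 0`.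

For `a < |μ| < b` these norms decay geometrically in both directions, and off the closed ring they
fail to tend to zero. On the circle `|μ| = a` the outcome depends on how the windows approach `a`:
from above the norms do not decrease, while from below, at distance at least `a / (k + 1)`, they
decrease like `1 / k` or faster, which is square summable. The circle `|μ| = b`
is the same case for the inverse weights.
-/

section HilbertSum

variable {𝕜 H ι : Type*} [RCLike 𝕜] [NormedAddCommGroup H] [InnerProductSpace 𝕜 H]

theorem starProjection_apply_of_isOrtho {K L : Submodule 𝕜 H} [L.HasOrthogonalProjection]
    (h : K ⟂ L) {x : H} (hx : x ∈ K) : L.starProjection x = 0 :=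
  L.starProjection_apply_eq_zero_iff.2 (h hx)

variable [CompleteSpace H]

theorem hasSum_starProjection {K : ι → Submodule 𝕜 H} [∀ i, CompleteSpace (K i)]
    (hK : IsHilbertSum 𝕜 (fun i => K i) fun i => (K i).subtypeₗᵢ) (x : H) :
    HasSum (fun i => (K i).starProjection x) x := by
  obtain ⟨w, rfl⟩ := hK.linearIsometryEquiv.symm.surjective x
  have hw := hK.hasSum_linearIsometryEquiv_symm w
  convert hw using 2 with i
  refine (hw.mapL (K i).starProjection).unique ?_
  convert hasSum_single i fun j hj => ?_
  · exact (Submodule.starProjection_eq_self_iff.2 (w i).2).symm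
  · exact starProjection_apply_of_isOrtho (hK.OrthogonalFamily.isOrtho hj) (w j).2

theorem tendsto_norm_starProjection {K : ι → Submodule 𝕜 H} [∀ i, CompleteSpace (K i)]
    (hK : IsHilbertSum 𝕜 (fun i => K i) fun i => (K i).subtypeₗᵢ) (x : H) :
    Tendsto (fun i => ‖(K i).starProjection x‖) cofinite (𝓝 0) := by
  simpa only [norm_zero] using (hasSum_starProjection hK x).summable.tendsto_cofinite_zero.norm

end HilbertSum

section CompletedFamily

variable {𝕜 H ι : Type*} [RCLike 𝕜] [NormedAddCommGroup H] [InnerProductSpace 𝕜 H]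

/-- The family `E` with its member at `i₀` enlarged to the orthogonal complement of all the other
members, so that an orthogonal family becomes a decomposition of the whole space. -/
noncomputable def completedFamily [DecidableEq ι] (E : ι → Submodule 𝕜 H) (i₀ : ι) :
    ι → Submodule 𝕜 H :=
  Function.update E i₀ (⨅ j ≠ i₀, (E j)ᗮ)

variable [DecidableEq ι] {E : ι → Submodule 𝕜 H} {i₀ : ι}

theorem completedFamily_of_ne {i : ι} (hi : i ≠ i₀) : completedFamily E i₀ i = E i :=
  Function.update_of_ne hi ..

theorem mem_completedFamily_self {x : H} :
    x ∈ completedFamily E i₀ i₀ ↔ ∀ j ≠ i₀, x ∈ (E j)ᗮ := by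
  simp only [completedFamily, Function.update_self, Submodule.mem_iInf]

theorem le_completedFamily (hE : Pairwise fun i j => E i ⟂ E j) (i : ι) :
    E i ≤ completedFamily E i₀ i := by
  obtain rfl | hi := eq_or_ne i i₀
  · exact fun x hx => mem_completedFamily_self.2 fun j hj => hE hj.symm hx
  · exact (completedFamily_of_ne hi).ge

theorem isClosed_completedFamily (hE : ∀ i, IsClosed (E i : Set H)) (i : ι) :
    IsClosed (completedFamily E i₀ i : Set H) := by
  obtain rfl | hi := eq_or_ne i i₀
  · simp only [completedFamily, Function.update_self, Submodule.coe_iInf]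
    exact isClosed_iInter fun j => isClosed_iInter fun _ => (E j).isClosed_orthogonal
  · rw [completedFamily_of_ne hi]
    exact hE i

theorem pairwise_isOrtho_completedFamily (hE : Pairwise fun i j => E i ⟂ E j) :
    Pairwise fun i j => completedFamily E i₀ i ⟂ completedFamily E i₀ j := by
  have self_isOrtho {j : ι} (hj : j ≠ i₀) : completedFamily E i₀ i₀ ⟂ completedFamily E i₀ j := by
    rw [completedFamily_of_ne hj]
    exact fun x hx => mem_completedFamily_self.1 hx j hj
  intro i j hij
  obtain rfl | hi := eq_or_ne i i₀
  · exact self_isOrtho hij.symm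
  obtain rfl | hj := eq_or_ne j i₀
  · exact (self_isOrtho hi).symm
  · rw [completedFamily_of_ne hi, completedFamily_of_ne hj]
    exact hE hij

variable [CompleteSpace H]

theorem isHilbertSum_completedFamily (hcl : ∀ i, IsClosed (E i : Set H))
    (hE : Pairwise fun i j => E i ⟂ E j) :
    IsHilbertSum 𝕜 (fun i => completedFamily E i₀ i)
      fun i => (completedFamily E i₀ i).subtypeₗᵢ := by
  have (i : ι) := (isClosed_completedFamily (i₀ := i₀) hcl i).completeSpace_coe
  refine IsHilbertSum.mkInternal _
    (OrthogonalFamily.of_pairwise (pairwise_isOrtho_completedFamily hE)) ?_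
  rw [top_le_iff, Submodule.topologicalClosure_eq_top_iff, eq_bot_iff]
  intro x hx
  rw [← Submodule.iInf_orthogonal, Submodule.mem_iInf] at hx
  have hx₀ : x ∈ completedFamily E i₀ i₀ := mem_completedFamily_self.2 fun j hj =>
    completedFamily_of_ne (E := E) hj ▸ hx j
  exact inner_self_eq_zero.1 ((hx i₀) x hx₀)

theorem apply_mem_completedFamily {A : H →L[𝕜] H} (hA : IsSelfAdjoint A)
    (hAE : ∀ i, ∀ x ∈ E i, A x ∈ E i) (i : ι) {x : H} (hx : x ∈ completedFamily E i₀ i) :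
    A x ∈ completedFamily E i₀ i := by
  obtain rfl | hi := eq_or_ne i i₀
  · refine mem_completedFamily_self.2 fun j hj y hy => ?_
    rw [← ContinuousLinearMap.adjoint_inner_left, hA.adjoint_eq]
    exact mem_completedFamily_self.1 hx j hj _ (hAE j y hy)
  · rw [completedFamily_of_ne hi] at hx ⊢
    exact hAE i x hx

end CompletedFamily

section HilbertBasis

variable {𝕜 H ι κ : Type*} [RCLike 𝕜] [NormedAddCommGroup H] [InnerProductSpace 𝕜 H]

theorem countable_of_orthonormal [TopologicalSpace.SeparableSpace H] {v : ι → H}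
    (hv : Orthonormal 𝕜 v) : Countable ι := by
  have hball : Pairwise (Function.onFun Disjoint fun i => Metric.ball (v i) (1 / 2)) := by
    intro i j hij
    refine Metric.ball_disjoint_ball ?_
    have hdist : ‖v i - v j‖ ^ 2 = 2 := by
      rw [@norm_sub_sq 𝕜, hv.2 hij, hv.1 i, hv.1 j]
      norm_num
    rw [dist_eq_norm]
    nlinarith [norm_nonneg (v i - v j)]
  exact hball.countable_of_isOpen_disjoint (fun _ => Metric.isOpen_ball)
    fun i => ⟨v i, Metric.mem_ball_self (by norm_num)⟩

variable [CompleteSpace H]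

/-- The Hilbert basis `b ∘ σ` obtained by reindexing `b` along a bijection of index types. -/
noncomputable def reindexHilbertBasis (b : HilbertBasis ι 𝕜 H) (σ : κ ≃ ι) : HilbertBasis κ 𝕜 H :=
  HilbertBasis.mk (b.orthonormal.comp σ σ.injective) <| by
    rw [σ.surjective.range_comp, b.dense_span]

theorem reindexHilbertBasis_apply (b : HilbertBasis ι 𝕜 H) (σ : κ ≃ ι) (k : κ) :
    reindexHilbertBasis b σ k = b (σ k) := by
  simp only [reindexHilbertBasis, HilbertBasis.coe_mk, Function.comp_apply]

/-- The unitary operator permuting the members of a Hilbert basis according to `σ`. -/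
noncomputable def permuteHilbertBasis (b : HilbertBasis ι 𝕜 H) (σ : Equiv.Perm ι) : H ≃ₗᵢ[𝕜] H :=
  b.repr.trans (reindexHilbertBasis b σ).repr.symm

theorem permuteHilbertBasis_apply_self (b : HilbertBasis ι 𝕜 H) (σ : Equiv.Perm ι) (i : ι) :
    permuteHilbertBasis b σ (b i) = b (σ i) := by
  classical
  simp only [permuteHilbertBasis, LinearIsometryEquiv.trans_apply, HilbertBasis.repr_self,
    HilbertBasis.repr_symm_single, reindexHilbertBasis_apply]

theorem nonempty_hilbertBasis_nat [TopologicalSpace.SeparableSpace H]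
    (hH : ¬ FiniteDimensional 𝕜 H) : Nonempty (HilbertBasis ℕ 𝕜 H) := by
  obtain ⟨w, b, -⟩ := exists_hilbertBasis 𝕜 H
  have : Countable w := countable_of_orthonormal b.orthonormal
  have : Infinite w := by
    by_contra hfin
    rw [not_infinite_iff_finite] at hfin
    have := Fintype.ofFinite w
    exact hH b.toOrthonormalBasis.toBasis.finiteDimensional_of_finite
  obtain ⟨σ⟩ := nonempty_equiv_of_countable (α := ℕ) (β := w)
  exact ⟨reindexHilbertBasis b σ⟩

theorem exists_hilbertBasis_prod {K : ι → Submodule 𝕜 H} [∀ i, CompleteSpace (K i)]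
    (hK : IsHilbertSum 𝕜 (fun i => K i) fun i => (K i).subtypeₗᵢ)
    (b : ∀ i, HilbertBasis κ 𝕜 (K i)) :
    ∃ e : HilbertBasis (ι × κ) 𝕜 H, ∀ i k, e (i, k) = b i k := by
  have orthonormal_b : Orthonormal 𝕜 fun p : ι × κ => (b p.1 p.2 : H) :=
    (hK.OrthogonalFamily.orthonormal_sigma_orthonormal fun i => (b i).orthonormal).comp
      (Equiv.sigmaEquivProd ι κ).symm (Equiv.injective _)
  refine ⟨HilbertBasis.mkOfOrthogonalEqBot orthonormal_b (eq_bot_iff.2 fun x hx => ?_),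
    fun i k => by rw [HilbertBasis.coe_mkOfOrthogonalEqBot]⟩
  have inner_eq_zero (i : ι) (k : κ) : inner 𝕜 (b i k : H) x = 0 :=
    hx _ (Submodule.subset_span ⟨(i, k), rfl⟩)
  have orthogonalProjection_eq_zero (i : ι) : (K i).orthogonalProjectionOnto x = 0 := by
    refine (map_eq_zero_iff (b i).repr (b i).repr.injective).1 (lp.ext (funext fun k => ?_))
    rw [HilbertBasis.repr_apply_apply, Submodule.inner_orthogonalProjectionOnto_eq_of_mem_left,
      inner_eq_zero, lp.coeFn_zero, Pi.zero_apply]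
  refine (hasSum_starProjection hK x).unique ?_
  simp only [Submodule.starProjection_apply, orthogonalProjection_eq_zero, Submodule.coe_zero]
  exact hasSum_zero

end HilbertBasis

section Shift

variable {𝕜 H : Type*} [RCLike 𝕜] [NormedAddCommGroup H] [InnerProductSpace 𝕜 H] [CompleteSpace H]

/-- `T` is a bilateral shift along `K`: the space is the Hilbert sum of the subspaces `K n`,
`n ∈ ℤ`, and `T` maps each `K n` into `K (n + 1)`. Neither injectivity nor surjectivity is part of
the notion. -/
structure IsShift (T : H →L[𝕜] H) (K : ℤ → Submodule 𝕜 H) : Prop where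
  isHilbertSum : IsHilbertSum 𝕜 (fun n => K n) fun n => (K n).subtypeₗᵢ
  apply_mem : ∀ n, ∀ x ∈ K n, T x ∈ K (n + 1)

namespace IsShift

variable {T : H →L[𝕜] H} {K : ℤ → Submodule 𝕜 H}

theorem comp (hT : IsShift T K) {A : H →L[𝕜] H} (hA : ∀ n, ∀ x ∈ K n, A x ∈ K n) :
    IsShift (T ∘L A) K :=
  ⟨hT.isHilbertSum, fun n x hx => hT.apply_mem n _ (hA n x hx)⟩

variable [∀ n, CompleteSpace (K n)]

theorem starProjection_succ_apply (hT : IsShift T K) (n : ℤ) (x : H) :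
    (K (n + 1)).starProjection (T x) = T ((K n).starProjection x) := by
  have hsum := (hasSum_starProjection hT.isHilbertSum x).mapL ((K (n + 1)).starProjection ∘L T)
  refine hsum.unique ?_
  convert hasSum_single n fun i hi => ?_ using 1
  · exact (Submodule.starProjection_eq_self_iff.2
      (hT.apply_mem n _ ((K n).starProjection_apply_mem x))).symm
  · exact starProjection_apply_of_isOrtho
      (hT.isHilbertSum.OrthogonalFamily.isOrtho ((add_left_injective 1).ne hi))
      (hT.apply_mem i _ ((K i).starProjection_apply_mem x))

theorem mem_of_apply_mem (hT : IsShift T K) (hinj : Function.Injective T) {n : ℤ} {x : H}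
    (hx : T x ∈ K (n + 1)) : x ∈ K n := by
  rw [← Submodule.starProjection_eq_self_iff]
  apply hinj
  rw [← hT.starProjection_succ_apply, Submodule.starProjection_eq_self_iff]
  exact hx

theorem surjOn (hT : IsShift T K) (hbij : Function.Bijective T) (n : ℤ) :
    Set.SurjOn T (K n) (K (n + 1)) := fun y hy => by
  obtain ⟨x, rfl⟩ := hbij.surjective y
  exact ⟨x, hT.mem_of_apply_mem hbij.injective hy, rfl⟩

variable {μ : 𝕜} {x : H}

theorem apply_starProjection (hT : IsShift T K) (hx : T x = μ • x) (n : ℤ) :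
    T ((K n).starProjection x) = μ • (K (n + 1)).starProjection x := by
  rw [← hT.starProjection_succ_apply, hx, map_smul]

theorem norm_apply_starProjection (hT : IsShift T K) (hx : T x = μ • x) (n : ℤ) :
    ‖T ((K n).starProjection x)‖ = ‖μ‖ * ‖(K (n + 1)).starProjection x‖ := by
  rw [hT.apply_starProjection hx, norm_smul]

theorem starProjection_ne_zero (hT : IsShift T K) (hinj : Function.Injective T) (hμ : μ ≠ 0)
    (hx₀ : x ≠ 0) (hx : T x = μ • x) (n : ℤ) : (K n).starProjection x ≠ 0 := by
  have succ_iff (i : ℤ) : (K (i + 1)).starProjection x = 0 ↔ (K i).starProjection x = 0 := by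
    rw [← smul_eq_zero_iff_right hμ, ← hT.apply_starProjection hx, map_eq_zero_iff T hinj]
  intro hn
  have forall_eq_zero (i : ℤ) : (K i).starProjection x = 0 := by
    induction i using Int.inductionOn' (b := n) with
    | zero => exact hn
    | succ i _ ih => exact (succ_iff i).2 ih
    | pred i _ ih => exact (succ_iff (i - 1)).1 (by rwa [sub_add_cancel])
  refine hx₀ ((hasSum_starProjection hT.isHilbertSum x).unique ?_)
  simp only [forall_eq_zero]
  exact hasSum_zero

end IsShift

end Shift

section BilateralChoice

variable {α : Type*} {a : α}

theorem exists_nat_seq {p : ℕ → α → Prop} {r : α → α → Prop} (h₀ : p 0 a)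
    (hsucc : ∀ n x, p n x → ∃ y, p (n + 1) y ∧ r x y) :
    ∃ u : ℕ → α, u 0 = a ∧ (∀ n, p n (u n)) ∧ ∀ n, r (u n) (u (n + 1)) := by
  choose f hp hr using hsucc
  let v (n : ℕ) : {x // p n x} := n.rec ⟨a, h₀⟩ fun n x => ⟨f n x x.2, hp n x x.2⟩
  exact ⟨fun n => (v n).1, rfl, fun n => (v n).2, fun n => hr n (v n).1 (v n).2⟩

theorem exists_int_seq {p : ℤ → α → Prop} {r : α → α → Prop} (h₀ : p 0 a)
    (hsucc : ∀ n ≥ 0, ∀ x, p n x → ∃ y, p (n + 1) y ∧ r x y)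
    (hpred : ∀ n < 0, ∀ y, p (n + 1) y → ∃ x, p n x ∧ r x y) :
    ∃ u : ℤ → α, u 0 = a ∧ (∀ n, p n (u n)) ∧ ∀ n, r (u n) (u (n + 1)) := by
  obtain ⟨f, f_zero, hpf, hrf⟩ := exists_nat_seq (p := fun k => p k) h₀ fun k x hx =>
    hsucc k (Int.natCast_nonneg k) x hx
  obtain ⟨g, g_zero, hpg, hrg⟩ := exists_nat_seq (p := fun k => p (-k)) (r := fun x y => r y x) h₀
    fun k x hx => hpred (-(k + 1 : ℕ)) (by omega) x (by convert hx using 1; push_cast; ring)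
  refine ⟨fun n => Int.casesOn n f fun k => g (k + 1), f_zero, ?_, ?_⟩
  · rintro (k | k)
    · exact hpf k
    · exact hpg (k + 1)
  · rintro (k | _ | k)
    · exact hrf k
    · change r (g (0 + 1)) (f 0)
      rw [f_zero, ← g_zero]
      exact hrg 0
    · exact hrg (k + 1)

end BilateralChoice

section Cutoff

/-- The windows `[c k, d k]` sort the positive reals into those in `S`, which exceed the `d k` with
the margin of Raabe's test, and the others, which are eventually at most `c k`. Accordingly, for a
positive sequence whose ratios `a (k + 1) / a k` lie in the windows divided by `r`, membership of
`r` in `S` decides between square summability and failure to tend to zero. -/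
structure IsCutoff (c d : ℕ → ℝ) (S : Set ℝ) : Prop where
  eventually_mul_le : ∀ r ∈ S, ∀ᶠ k : ℕ in atTop, d k * (k + 1) ≤ r * k
  eventually_le : ∀ r ∉ S, ∀ᶠ k : ℕ in atTop, r ≤ c k

theorem not_tendsto_zero_of_eventually_le_succ {a : ℕ → ℝ} (ha : ∀ k, 0 < a k)
    (hle : ∀ᶠ k in atTop, a k ≤ a (k + 1)) : ¬ Tendsto a atTop (𝓝 0) := by
  intro hlim
  obtain ⟨N, hN⟩ := eventually_atTop.1 hle
  have le_of_le {k : ℕ} (hk : N ≤ k) : a N ≤ a k := Nat.le_induction le_rfl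
    (fun k hk ih => ih.trans (hN k hk)) k hk
  exact (ha N).not_ge (ge_of_tendsto hlim (eventually_atTop.2 ⟨N, fun _ => le_of_le⟩))

theorem summable_sq_of_eventually_succ_mul_le {a : ℕ → ℝ} (ha : ∀ k, 0 ≤ a k)
    (hle : ∀ᶠ k : ℕ in atTop, (k + 1) * a (k + 1) ≤ k * a k) : Summable fun k => a k ^ 2 := by
  obtain ⟨N, hN⟩ := eventually_atTop.1 hle
  have mul_le {k : ℕ} (hk : N ≤ k) : k * a k ≤ N * a N := by
    induction k, hk using Nat.le_induction with
    | base => exact le_rfl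
    | succ k hk ih => exact_mod_cast (hN k hk).trans ih
  have summable_bound : Summable fun k : ℕ => (N * a N) ^ 2 * (1 / (k : ℝ) ^ 2) :=
    (Real.summable_one_div_nat_pow.2 one_lt_two).mul_left _
  refine summable_bound.of_norm_bounded_eventually_nat ?_
  filter_upwards [eventually_ge_atTop N, eventually_gt_atTop 0] with k hk hk₀
  have hk₀ : (0 : ℝ) < k := Nat.cast_pos.2 hk₀
  rw [Real.norm_of_nonneg (sq_nonneg _), mul_one_div, le_div_iff₀ (by positivity), ← mul_pow,
    mul_comm (a k)]
  exact pow_le_pow_left₀ (mul_nonneg hk₀.le (ha k)) (mul_le hk) 2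

namespace IsCutoff

variable {c d a : ℕ → ℝ} {S : Set ℝ} {r : ℝ}

theorem mem (h : IsCutoff c d S) (hr : 0 < r) (ha : ∀ k, 0 < a k)
    (hle : ∀ᶠ k in atTop, c k * a k ≤ r * a (k + 1)) (hlim : Tendsto a atTop (𝓝 0)) : r ∈ S := by
  by_contra hrS
  refine not_tendsto_zero_of_eventually_le_succ ha ?_ hlim
  filter_upwards [hle, h.eventually_le r hrS] with k hk hrc
  exact le_of_mul_le_mul_left ((mul_le_mul_of_nonneg_right hrc (ha k).le).trans hk) hr

theorem summable_sq (h : IsCutoff c d S) (hr : 0 < r) (hrS : r ∈ S) (ha : ∀ k, 0 ≤ a k)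
    (hle : ∀ᶠ k in atTop, r * a (k + 1) ≤ d k * a k) : Summable fun k => a k ^ 2 := by
  refine summable_sq_of_eventually_succ_mul_le ha ?_
  filter_upwards [hle, h.eventually_mul_le r hrS] with k hk hdr
  refine le_of_mul_le_mul_left ?_ hr
  calc r * ((k + 1) * a (k + 1)) = (k + 1) * (r * a (k + 1)) := by ring
    _ ≤ (k + 1) * (d k * a k) := by gcongr
    _ = d k * (k + 1) * a k := by ring
    _ ≤ r * k * a k := mul_le_mul_of_nonneg_right hdr (ha k)
    _ = r * (k * a k) := by ring

end IsCutoff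

section Bilateral

variable {p q a : ℤ → ℝ} {S₁ S₂ : Set ℝ} {r : ℝ}

theorem mem_and_inv_mem_of_tendsto_zero (h₁ : IsCutoff (fun k => p k) (fun k => q k) S₁)
    (h₂ : IsCutoff (fun k => (q (-(k + 1)))⁻¹) (fun k => (p (-(k + 1)))⁻¹) S₂) (hr : 0 < r)
    (hq : ∀ n ≠ 0, 0 < q n) (ha : ∀ n, 0 < a n) (hlow : ∀ n ≠ 0, p n * a n ≤ r * a (n + 1))
    (hup : ∀ n ≠ 0, r * a (n + 1) ≤ q n * a n) (hlim : Tendsto a cofinite (𝓝 0)) :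
    r ∈ S₁ ∧ r⁻¹ ∈ S₂ := by
  rw [Int.cofinite_eq, tendsto_sup] at hlim
  refine ⟨h₁.mem (a := fun k => a k) hr (fun k => ha k) ?_
    (hlim.2.comp tendsto_natCast_atTop_atTop),
    h₂.mem (a := fun k => a (-k)) (inv_pos.2 hr) (fun k => ha (-k)) (.of_forall fun k => ?_)
    (hlim.1.comp (tendsto_neg_atTop_atBot.comp tendsto_natCast_atTop_atTop))⟩
  · filter_upwards [eventually_ne_atTop 0] with k hk
    exact_mod_cast hlow k (Nat.cast_ne_zero.2 hk)
  · have hup := hup (-(k + 1)) (by omega)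
    rw [show -((k : ℤ) + 1) + 1 = -k by ring] at hup
    push_cast
    rw [inv_mul_le_iff₀ (hq _ (by omega))]
    field_simp
    linarith

theorem summable_sq_of_mem_of_inv_mem (h₁ : IsCutoff (fun k => p k) (fun k => q k) S₁)
    (h₂ : IsCutoff (fun k => (q (-(k + 1)))⁻¹) (fun k => (p (-(k + 1)))⁻¹) S₂) (hr : 0 < r)
    (hp : ∀ n ≠ 0, 0 < p n) (ha : ∀ n, 0 ≤ a n) (hlow : ∀ n ≠ 0, p n * a n ≤ r * a (n + 1))
    (hup : ∀ n ≠ 0, r * a (n + 1) ≤ q n * a n) (hr₁ : r ∈ S₁) (hr₂ : r⁻¹ ∈ S₂) :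
    Summable fun n => a n ^ 2 := by
  refine .of_nat_of_neg
    (h₁.summable_sq (a := fun k => a k) hr hr₁ (fun k => ha k) ?_)
    (h₂.summable_sq (a := fun k => a (-k)) (inv_pos.2 hr) hr₂ (fun k => ha (-k))
      (.of_forall fun k => ?_))
  · filter_upwards [eventually_ne_atTop 0] with k hk
    exact_mod_cast hup k (Nat.cast_ne_zero.2 hk)
  · have hlow := hlow (-(k + 1)) (by omega)
    rw [show -((k : ℤ) + 1) + 1 = -k by ring] at hlow
    push_cast
    have := hp (-((k : ℤ) + 1)) (by omega)
    field_simp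
    linarith

end Bilateral

end Cutoff

section ShiftPointSpectrum

variable {𝕜 H : Type*} [RCLike 𝕜] [NormedAddCommGroup H] [InnerProductSpace 𝕜 H] [CompleteSpace H]
  {T : H →L[𝕜] H} {K : ℤ → Submodule 𝕜 H} {p q : ℤ → ℝ} {S₁ S₂ : Set ℝ} {μ : 𝕜}

namespace IsShift

theorem exists_apply_eq_smul_of_summable (hT : IsShift T K) {y : ℤ → H} (hy : ∀ n, y n ∈ K n)
    (hTy : ∀ n, T (y n) = μ • y (n + 1)) (hsum : Summable fun n => ‖y n‖ ^ 2) (hy₀ : y 0 ≠ 0) :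
    ∃ x ≠ 0, T x = μ • x := by
  have orthogonal := hT.isHilbertSum.OrthogonalFamily
  obtain ⟨x, hx⟩ : Summable y :=
    (orthogonal.summable_iff_norm_sq_summable fun n => ⟨y n, hy n⟩).2 hsum
  refine ⟨x, ?_, ?_⟩
  · rintro rfl
    have inner_y₀ := hx.mapL (innerSL 𝕜 (y 0))
    have inner_of_ne (n : ℤ) (hn : n ≠ 0) : innerSL 𝕜 (y 0) (y n) = 0 :=
      (orthogonal.isOrtho hn.symm).inner_eq (hy 0) (hy n)
    exact hy₀ (inner_self_eq_zero.1
      ((hasSum_single 0 inner_of_ne).unique (by simpa only [map_zero] using inner_y₀)))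
  · have hTx := hx.mapL T
    simp only [hTy] at hTx
    exact hTx.unique (((Equiv.addRight (1 : ℤ)).hasSum_iff.2 hx).const_smul μ)

theorem exists_apply_eq_smul_of_isCutoff (hT : IsShift T K) (hK : K 0 ≠ ⊥)
    (hsurj : ∀ n < 0, Set.SurjOn T (K n) (K (n + 1))) (hp : ∀ n ≠ 0, 0 < p n)
    (hlow : ∀ n ≠ 0, ∀ x ∈ K n, p n * ‖x‖ ≤ ‖T x‖) (hup : ∀ n ≠ 0, ∀ x ∈ K n, ‖T x‖ ≤ q n * ‖x‖)
    (h₁ : IsCutoff (fun k => p k) (fun k => q k) S₁)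
    (h₂ : IsCutoff (fun k => (q (-(k + 1)))⁻¹) (fun k => (p (-(k + 1)))⁻¹) S₂)
    (hμ₀ : μ ≠ 0) (hμ₁ : ‖μ‖ ∈ S₁) (hμ₂ : ‖μ‖⁻¹ ∈ S₂) : ∃ x ≠ 0, T x = μ • x := by
  obtain ⟨v, hv, hv₀⟩ := Submodule.exists_mem_ne_zero_of_ne_bot hK
  obtain ⟨y, rfl, hy, hTy⟩ := exists_int_seq (p := fun n x => x ∈ K n)
    (r := fun x y => T x = μ • y) hv
    (fun n _ x hx => ⟨μ⁻¹ • T x, (K _).smul_mem _ (hT.apply_mem n x hx), by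
      rw [smul_inv_smul₀ hμ₀]⟩)
    (fun n hn y hy => hsurj n hn ((K _).smul_mem μ hy))
  have norm_hTy (n : ℤ) : ‖T (y n)‖ = ‖μ‖ * ‖y (n + 1)‖ := by rw [hTy, norm_smul]
  refine hT.exists_apply_eq_smul_of_summable hy hTy ?_ hv₀
  exact summable_sq_of_mem_of_inv_mem h₁ h₂ (norm_pos_iff.2 hμ₀) hp (fun _ => norm_nonneg _)
    (fun n hn => norm_hTy n ▸ hlow n hn _ (hy n)) (fun n hn => norm_hTy n ▸ hup n hn _ (hy n))
    hμ₁ hμ₂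

theorem norm_mem_of_apply_eq_smul [∀ n, CompleteSpace (K n)] (hT : IsShift T K)
    (hinj : Function.Injective T) (hq : ∀ n ≠ 0, 0 < q n)
    (hlow : ∀ n ≠ 0, ∀ x ∈ K n, p n * ‖x‖ ≤ ‖T x‖) (hup : ∀ n ≠ 0, ∀ x ∈ K n, ‖T x‖ ≤ q n * ‖x‖)
    (h₁ : IsCutoff (fun k => p k) (fun k => q k) S₁)
    (h₂ : IsCutoff (fun k => (q (-(k + 1)))⁻¹) (fun k => (p (-(k + 1)))⁻¹) S₂)
    {x : H} (hx₀ : x ≠ 0) (hx : T x = μ • x) : ‖μ‖ ∈ S₁ ∧ ‖μ‖⁻¹ ∈ S₂ := by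
  have hμ₀ : μ ≠ 0 := by
    rintro rfl
    exact hx₀ ((map_eq_zero_iff T hinj).1 (by rw [hx, zero_smul]))
  have starProjection_mem (n : ℤ) : (K n).starProjection x ∈ K n :=
    (K n).starProjection_apply_mem x
  exact mem_and_inv_mem_of_tendsto_zero h₁ h₂ (norm_pos_iff.2 hμ₀) hq
    (fun n => norm_pos_iff.2 (hT.starProjection_ne_zero hinj hμ₀ hx₀ hx n))
    (fun n hn => hT.norm_apply_starProjection hx n ▸ hlow n hn _ (starProjection_mem n))
    (fun n hn => hT.norm_apply_starProjection hx n ▸ hup n hn _ (starProjection_mem n))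
    (tendsto_norm_starProjection hT.isHilbertSum x)

end IsShift

end ShiftPointSpectrum

section Windows

/-- The bilateral sequence with entries `f 0, f 1, …` at `0, 1, …` and `g 0, g 1, …` at
`-1, -2, …`. -/
def bilateralSeq {α : Type*} (f g : ℕ → α) : ℤ → α
  | .ofNat k => f k
  | .negSucc k => g k

/-- Pairwise disjoint nondegenerate compact intervals `[c i, d i]` inside `G`. -/
structure IsWindowFamily {ι : Type*} (c d : ι → ℝ) (G : Set ℝ) : Prop where
  lt : ∀ i, c i < d i
  subset : ∀ i, Set.Icc (c i) (d i) ⊆ G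
  disjoint : Pairwise (Function.onFun Disjoint fun i => Set.Icc (c i) (d i))

theorem isWindowFamily_of_strictMono {u : ℕ → ℝ} (hu : StrictMono u) {G : Set ℝ}
    (hG : ∀ i j, Set.Icc (u i) (u j) ⊆ G) :
    IsWindowFamily (fun k => u (2 * k)) (fun k => u (2 * k + 1)) G where
  lt k := hu (Nat.lt_succ_self _)
  subset k := hG _ _
  disjoint := (pairwise_disjoint_on _).2 fun i j hij =>
    Set.disjoint_left.2 fun _ hi hj => ((hu (by lia)).trans_le hj.1).not_ge hi.2

theorem isWindowFamily_of_strictAnti {u : ℕ → ℝ} (hu : StrictAnti u) {G : Set ℝ}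
    (hG : ∀ i j, Set.Icc (u i) (u j) ⊆ G) :
    IsWindowFamily (fun k => u (2 * k + 1)) (fun k => u (2 * k)) G where
  lt k := hu (Nat.lt_succ_self _)
  subset k := hG _ _
  disjoint := (pairwise_disjoint_on _).2 fun i j hij =>
    Set.disjoint_left.2 fun _ hi hj => (hj.2.trans_lt (hu (by lia))).not_ge hi.1

namespace IsWindowFamily

variable {G : Set ℝ}

theorem mono {ι : Type*} {c d : ι → ℝ} (h : IsWindowFamily c d G) {G' : Set ℝ} (hG : G ⊆ G') :
    IsWindowFamily c d G' :=
  ⟨h.lt, fun i => (h.subset i).trans hG, h.disjoint⟩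

theorem inv {ι : Type*} {c d : ι → ℝ} (h : IsWindowFamily c d G) (hG : G ⊆ Set.Ioi 0) :
    IsWindowFamily (fun i => (d i)⁻¹) (fun i => (c i)⁻¹) (Inv.inv ⁻¹' G) := by
  have c_pos (i : ι) : 0 < c i := hG (h.subset i (Set.left_mem_Icc.2 (h.lt i).le))
  have Icc_inv_subset (i : ι) :
      Set.Icc (d i)⁻¹ (c i)⁻¹ ⊆ Inv.inv ⁻¹' Set.Icc (c i) (d i) := fun x hx => by
    have hd := (c_pos i).trans (h.lt i)
    have hx₀ : 0 < x := (inv_pos.2 hd).trans_le hx.1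
    exact ⟨(le_inv_comm₀ hx₀ (c_pos i)).1 hx.2, (inv_le_comm₀ hd hx₀).1 hx.1⟩
  exact
    { lt i := inv_strictAnti₀ (c_pos i) (h.lt i)
      subset i := (Icc_inv_subset i).trans (Set.preimage_mono (h.subset i))
      disjoint i j hij :=
        ((h.disjoint hij).preimage Inv.inv).mono (Icc_inv_subset i) (Icc_inv_subset j) }

theorem bilateral {c d c' d' : ℕ → ℝ} {m : ℝ} (h : IsWindowFamily c d (Set.Iio m ∩ G))
    (h' : IsWindowFamily c' d' (Set.Ioi m ∩ G)) :
    IsWindowFamily (bilateralSeq c c') (bilateralSeq d d') G := by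
  have disjoint_left_right (i j : ℕ) : Disjoint (Set.Icc (c i) (d i)) (Set.Icc (c' j) (d' j)) :=
    (Set.Iio_disjoint_Ioi_same (a := m)).mono (fun _ hx => (h.subset i hx).1)
      fun _ hx => (h'.subset j hx).1
  refine ⟨?_, ?_, ?_⟩
  · rintro (k | k)
    exacts [h.lt k, h'.lt k]
  · rintro (k | k)
    exacts [fun x hx => (h.subset k hx).2, fun x hx => (h'.subset k hx).2]
  · rintro (i | i) (j | j) hij
    · exact h.disjoint fun hk => hij (congrArg _ hk)
    · exact disjoint_left_right i j
    · exact (disjoint_left_right j i).symm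
    · exact h'.disjoint fun hk => hij (congrArg _ hk)

end IsWindowFamily

variable {a : ℝ} {c d : ℕ → ℝ}

theorem isCutoff_Ioi (hc : ∀ k, a ≤ c k) (hd : Tendsto d atTop (𝓝 a)) :
    IsCutoff c d (Set.Ioi a) where
  eventually_mul_le r hr := by
    obtain ⟨s, has, hsr⟩ := exists_between (Set.mem_Ioi.1 hr)
    filter_upwards [hd.eventually_le_const has,
      tendsto_natCast_atTop_atTop.eventually_ge_atTop (s / (r - s))] with k hds hk
    rw [div_le_iff₀ (sub_pos.2 hsr)] at hk
    calc d k * (k + 1) ≤ s * (k + 1) := by gcongr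
      _ ≤ r * k := by linarith
  eventually_le r hr := .of_forall fun k => (not_lt.1 hr).trans (hc k)

theorem isCutoff_Ici (hc : Tendsto c atTop (𝓝 a)) (hd : ∀ᶠ k : ℕ in atTop, d k * (k + 1) ≤ a * k) :
    IsCutoff c d (Set.Ici a) where
  eventually_mul_le _ hr := hd.mono fun k hk =>
    hk.trans (mul_le_mul_of_nonneg_right hr k.cast_nonneg)
  eventually_le _ hr := hc.eventually_const_le (not_le.1 hr)

theorem exists_isWindowFamily_isCutoff_Ioi {m : ℝ} (ham : a < m) {G : Set ℝ}
    (hG : Set.Ioo a m ⊆ G) :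
    ∃ c d : ℕ → ℝ, IsWindowFamily c d G ∧ IsCutoff c d (Set.Ioi a) := by
  obtain ⟨u, hu, u_mem, hlim⟩ := exists_seq_strictAnti_tendsto' ham
  refine ⟨_, _, isWindowFamily_of_strictAnti hu fun i j => ?_,
    isCutoff_Ioi (fun k => (u_mem _).1.le)
      (hlim.comp (tendsto_id.const_mul_atTop' two_pos))⟩
  exact (Set.Icc_subset_Ioo (u_mem i).1 (u_mem j).2).trans hG

theorem exists_isWindowFamily_isCutoff_Ici (ha : 0 < a) {G : Set ℝ} (hG : G ∈ 𝓝 a) :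
    ∃ c d : ℕ → ℝ, IsWindowFamily c d G ∧ IsCutoff c d (Set.Ici a) := by
  obtain ⟨l, hla, hlG⟩ := exists_Ioc_subset_of_mem_nhds hG (exists_lt a)
  obtain ⟨J, hJ⟩ := exists_nat_gt (3 * a / (a - l))
  have hJ₀ : (0 : ℝ) < J := (by have := sub_pos.2 hla; positivity : 0 ≤ 3 * a / (a - l)).trans_lt hJ
  -- Any constant above `2` would do instead of `3`: `u (2 * k + 1)` has to stay below
  -- `a * (1 - 1 / (k + 1))`.
  let u (j : ℕ) : ℝ := a - 3 * a / (j + J)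
  have u_strictMono : StrictMono u := fun i j hij => by
    have : (i : ℝ) < j := Nat.cast_lt.2 hij
    exact sub_lt_sub_left (div_lt_div_of_pos_left (by positivity) (by positivity) (by gcongr)) _
  have u_tendsto : Tendsto u atTop (𝓝 a) := by
    have := (tendsto_natCast_atTop_atTop (R := ℝ)).atTop_add (tendsto_const_nhds (x := (J : ℝ)))
    simpa only [sub_zero] using tendsto_const_nhds.sub (this.const_div_atTop (3 * a))
  have lt_u (i : ℕ) : l < u i := by
    refine lt_of_lt_of_le ?_ (u_strictMono.monotone (Nat.zero_le i))
    rw [div_lt_comm₀ (sub_pos.2 hla) hJ₀] at hJ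
    simp only [u, Nat.cast_zero, zero_add]
    linarith
  refine ⟨_, _, isWindowFamily_of_strictMono u_strictMono fun i j => ?_,
    isCutoff_Ici (u_tendsto.comp (tendsto_id.const_mul_atTop' two_pos)) ?_⟩
  · exact (Set.Icc_subset_Ioc (lt_u i) (u_strictMono.monotone.ge_of_tendsto u_tendsto j)).trans hlG
  · filter_upwards [eventually_ge_atTop J] with k hk
    have hk : (J : ℝ) ≤ k := Nat.cast_le.2 hk
    have le_mul : a ≤ 3 * a / (2 * k + 1 + J) * (k + 1) := by
      rw [div_mul_eq_mul_div, le_div_iff₀ (by positivity)]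
      nlinarith
    simp only [u, Nat.cast_add, Nat.cast_mul, Nat.cast_ofNat, Nat.cast_one]
    linarith

end Windows

section AnnularRing

theorem exists_isWindowFamily_isCutoff {a m : ℝ} (ha : 0 < a) (ham : a < m) {S G : Set ℝ}
    (haS : Set.Ioi a ⊆ S) (hSa : S ⊆ Set.Ici a) (hG : ∀ r ∈ S, r < m → G ∈ 𝓝 r) :
    ∃ c d : ℕ → ℝ, IsWindowFamily c d (Set.Ioo 0 m ∩ G) ∧ IsCutoff c d S := by
  obtain rfl | rfl := Set.mem_Ici_Ioi_of_subset_of_subset haS hSa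
  · exact exists_isWindowFamily_isCutoff_Ici ha
      (inter_mem (Ioo_mem_nhds ha ham) (hG a Set.self_mem_Ici ham))
  · exact exists_isWindowFamily_isCutoff_Ioi ham fun r hr =>
      ⟨⟨ha.trans hr.1, hr.2⟩, mem_of_mem_nhds (hG r hr.1 hr.2)⟩

theorem IsAnnularRing.exists_eq_setOf {R : Set ℂ} (hR : IsAnnularRing R) :
    ∃ a b : ℝ, 0 < a ∧ a < b ∧ ∃ S₁ S₂ : Set ℝ, (Set.Ioi a ⊆ S₁ ∧ S₁ ⊆ Set.Ici a) ∧
      (Set.Ioi b⁻¹ ⊆ S₂ ∧ S₂ ⊆ Set.Ici b⁻¹) ∧ R = {z | ‖z‖ ∈ S₁ ∧ ‖z‖⁻¹ ∈ S₂} := by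
  obtain ⟨a, b, ha, hab, hR⟩ := hR
  have hb := ha.trans hab
  have inv_lt_inv_iff {r : ℝ} (hr : a ≤ r) : b⁻¹ < r⁻¹ ↔ r < b := inv_lt_inv₀ hb (ha.trans_le hr)
  have inv_le_inv_iff {r : ℝ} (hr : a ≤ r) : b⁻¹ ≤ r⁻¹ ↔ r ≤ b := inv_le_inv₀ hb (ha.trans_le hr)
  have Ioi_bounds (c : ℝ) : Set.Ioi c ⊆ Set.Ioi c ∧ Set.Ioi c ⊆ Set.Ici c :=
    ⟨subset_rfl, Set.Ioi_subset_Ici_self⟩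
  have Ici_bounds (c : ℝ) : Set.Ioi c ⊆ Set.Ici c ∧ Set.Ici c ⊆ Set.Ici c :=
    ⟨Set.Ioi_subset_Ici_self, subset_rfl⟩
  refine ⟨a, b, ha, hab, ?_⟩
  obtain rfl | rfl | rfl | rfl := hR
  · exact ⟨_, _, Ioi_bounds a, Ioi_bounds b⁻¹,
      Set.ext fun z => and_congr_right fun hz => (inv_lt_inv_iff hz.le).symm⟩
  · exact ⟨_, _, Ici_bounds a, Ici_bounds b⁻¹,
      Set.ext fun z => and_congr_right fun hz => (inv_le_inv_iff hz).symm⟩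
  · exact ⟨_, _, Ici_bounds a, Ioi_bounds b⁻¹,
      Set.ext fun z => and_congr_right fun hz => (inv_lt_inv_iff hz).symm⟩
  · exact ⟨_, _, Ioi_bounds a, Ici_bounds b⁻¹,
      Set.ext fun z => and_congr_right fun hz => (inv_le_inv_iff hz.le).symm⟩

theorem exists_isWindowFamily_of_isAnnularRing {R : Set ℂ} (hR : IsAnnularRing R) {G : Set ℝ}
    (hRG : ∀ z ∈ R, ‖z‖ ∈ interior G) :
    ∃ (p q : ℤ → ℝ) (S₁ S₂ : Set ℝ), IsWindowFamily p q (Set.Ioi 0 ∩ G) ∧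
      IsCutoff (fun k => p k) (fun k => q k) S₁ ∧
      IsCutoff (fun k => (q (-(k + 1)))⁻¹) (fun k => (p (-(k + 1)))⁻¹) S₂ ∧
      S₁ ⊆ Set.Ioi 0 ∧ R = {z | ‖z‖ ∈ S₁ ∧ ‖z‖⁻¹ ∈ S₂} := by
  obtain ⟨a, b, ha, hab, S₁, S₂, ⟨haS₁, hS₁a⟩, ⟨hbS₂, hS₂b⟩, rfl⟩ := hR.exists_eq_setOf
  obtain ⟨m, ham, hmb⟩ := exists_between hab
  have hm := ha.trans ham
  have hb := hm.trans hmb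
  have hS₁ : S₁ ⊆ Set.Ioi 0 := hS₁a.trans (Set.Ici_subset_Ioi.2 ha)
  have hS₂ : S₂ ⊆ Set.Ioi 0 := hS₂b.trans (Set.Ici_subset_Ioi.2 (inv_pos.2 hb))
  have mem_nhds {r : ℝ} (hr₁ : r ∈ S₁) (hr₂ : r⁻¹ ∈ S₂) : G ∈ 𝓝 r := by
    have norm_r : ‖(r : ℂ)‖ = r := Complex.norm_of_nonneg (hS₁ hr₁).le
    exact mem_interior_iff_mem_nhds.1 (norm_r ▸ hRG r ⟨norm_r.symm ▸ hr₁, norm_r.symm ▸ hr₂⟩)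
  obtain ⟨c, d, hwin, hcut⟩ := exists_isWindowFamily_isCutoff ha ham haS₁ hS₁a fun r hr hrm =>
    mem_nhds hr (hbS₂ ((inv_lt_inv₀ hb (hS₁ hr)).2 (hrm.trans hmb)))
  obtain ⟨c', d', hwin', hcut'⟩ := exists_isWindowFamily_isCutoff (inv_pos.2 hb)
    ((inv_lt_inv₀ hb hm).2 hmb) (G := Inv.inv ⁻¹' G) hbS₂ hS₂b fun s hs hsm =>
      (continuousAt_inv₀ (hS₂ hs).ne').preimage_mem_nhds
        (mem_nhds (haS₁ (ham.trans ((lt_inv_comm₀ (hS₂ hs) hm).1 hsm))) (by rwa [inv_inv]))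
  refine ⟨_, _, S₁, S₂, IsWindowFamily.bilateral (m := m) (hwin.mono ?_)
    ((hwin'.inv fun x hx => hx.1.1).mono ?_), hcut, ?_, hS₁, rfl⟩
  · exact fun x hx => ⟨hx.1.2, hx.1.1, hx.2⟩
  · rintro x ⟨⟨hx₀, hxm⟩, hx⟩
    simp only [Set.mem_preimage, inv_inv, inv_pos] at hx₀ hx
    exact ⟨(inv_lt_inv₀ hx₀ hm).1 hxm, hx₀, hx⟩
  · convert hcut' using 2 <;> exact inv_inv _

end AnnularRing

section SpectralSubspace

variable {H : Type*} [NormedAddCommGroup H] [InnerProductSpace ℂ H] [CompleteSpace H]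

/-- The spectral subspace of `A` for the closed set `s` of reals, described without
spectral projections: the vectors annihilated by `f(A)` for every continuous `f` vanishing
on `s`. -/
noncomputable def spectralSubspace (A : H →L[ℂ] H) (s : Set ℝ) : Submodule ℂ H :=
  ⨅ (f : ℝ → ℝ) (_ : Continuous f) (_ : Set.EqOn f 0 s), (cfc f A).ker

variable {A : H →L[ℂ] H} {s t : Set ℝ} {x y : H}

theorem mem_spectralSubspace :
    x ∈ spectralSubspace A s ↔
      ∀ f : ℝ → ℝ, Continuous f → Set.EqOn f 0 s → cfc f A x = 0 := by
  simp only [spectralSubspace, Submodule.mem_iInf, LinearMap.mem_ker, ContinuousLinearMap.coe_coe]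

theorem isClosed_spectralSubspace (A : H →L[ℂ] H) (s : Set ℝ) :
    IsClosed (spectralSubspace A s : Set H) := by
  simp only [spectralSubspace, Submodule.coe_iInf]
  exact isClosed_iInter fun f => isClosed_iInter fun _ => isClosed_iInter fun _ =>
    (cfc f A).isClosed_ker

theorem spectralSubspace_mono (A : H →L[ℂ] H) (hst : s ⊆ t) :
    spectralSubspace A s ≤ spectralSubspace A t := fun _ hx =>
  mem_spectralSubspace.2 fun f hf hft => mem_spectralSubspace.1 hx f hf (hft.mono hst)

theorem cfc_apply_congr {f g : ℝ → ℝ} (hx : x ∈ spectralSubspace A s) (hf : Continuous f)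
    (hg : Continuous g) (hfg : Set.EqOn f g s) : cfc f A x = cfc g A x := by
  have hsub := mem_spectralSubspace.1 hx (fun r => f r - g r) (hf.sub hg) fun r hr =>
    sub_eq_zero.2 (hfg hr)
  rw [cfc_sub f g A hf.continuousOn hg.continuousOn] at hsub
  exact sub_eq_zero.1 hsub

theorem cfc_apply_mem_spectralSubspace (g : ℝ → ℝ) (hx : x ∈ spectralSubspace A s) :
    cfc g A x ∈ spectralSubspace A s := mem_spectralSubspace.2 fun f hf hfs => by
  rw [← mul_apply_eq_comp, (cfc_commute_cfc f g A).eq, mul_apply_eq_comp,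
    mem_spectralSubspace.1 hx f hf hfs, map_zero]

theorem apply_mem_spectralSubspace (hA : IsSelfAdjoint A) (hx : x ∈ spectralSubspace A s) :
    A x ∈ spectralSubspace A s := by
  simpa only [cfc_id ℝ A] using cfc_apply_mem_spectralSubspace id hx

theorem inner_eq_zero_of_mem_spectralSubspace (hA : IsSelfAdjoint A) (hs : IsClosed s)
    (ht : IsClosed t) (hst : Disjoint s t) (hx : x ∈ spectralSubspace A s)
    (hy : y ∈ spectralSubspace A t) : inner ℂ x y = 0 := by
  obtain ⟨f, hf₀, hf₁, -⟩ := exists_continuous_zero_one_of_isClosed hs ht hst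
  have hfx : cfc f A x = 0 := mem_spectralSubspace.1 hx f f.continuous hf₀
  have hfy : cfc f A y = y := by
    rw [cfc_apply_congr hy f.continuous continuous_one hf₁]
    simp only [Pi.one_def, cfc_const_one ℝ A, one_apply_eq_self]
  have isSelfAdjoint_cfc : IsSelfAdjoint (cfc f A) := cfc_predicate _ A
  rw [← hfy, ← ContinuousLinearMap.adjoint_inner_left, isSelfAdjoint_cfc.adjoint_eq, hfx,
    inner_zero_left]

theorem cfc_apply_mem_of_eqOn_compl {f : ℝ → ℝ} (hf : Continuous f) (hfs : Set.EqOn f 0 sᶜ)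
    (x : H) : cfc f A x ∈ spectralSubspace A s := mem_spectralSubspace.2 fun g hg hgs => by
  have mul_eq_zero (r : ℝ) : g r * f r = 0 := by
    by_cases hr : r ∈ s
    · rw [hgs hr, Pi.zero_apply, zero_mul]
    · rw [hfs hr, Pi.zero_apply, mul_zero]
  rw [← mul_apply_eq_comp, ← cfc_mul g f A hg.continuousOn hf.continuousOn]
  simp only [mul_eq_zero, cfc_const_zero, zero_apply]

theorem spectralSubspace_ne_bot (hA : IsSelfAdjoint A) (hs : (interior s ∩ spectrum ℝ A).Nonempty) :
    spectralSubspace A s ≠ ⊥ := by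
  obtain ⟨r, hrs, hrA⟩ := hs
  obtain ⟨f, hf₀, hf₁, -⟩ := exists_continuous_zero_one_of_isClosed isOpen_interior.isClosed_compl
    isClosed_singleton (Set.disjoint_singleton_right.2 (Set.notMem_compl_iff.2 hrs))
  have f_eqOn_compl : Set.EqOn f 0 sᶜ := hf₀.mono (Set.compl_subset_compl.2 interior_subset)
  intro hbot
  have cfc_eq_zero : cfc f A = cfc (fun _ => 0 : ℝ → ℝ) A := by
    ext x
    have hx := cfc_apply_mem_of_eqOn_compl (A := A) f.continuous f_eqOn_compl x
    rw [hbot, Submodule.mem_bot] at hx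
    rw [hx, cfc_const_zero, zero_apply]
  rw [cfc_eq_cfc_iff_eqOn hA f.continuous.continuousOn continuousOn_const] at cfc_eq_zero
  exact one_ne_zero ((hf₁ rfl).symm.trans (cfc_eq_zero hrA))

theorem not_finiteDimensional_spectralSubspace (hA : IsSelfAdjoint A) {c d : ℝ} (hcd : c < d)
    (hspec : Set.Icc c d ⊆ spectrum ℝ A) :
    ¬ FiniteDimensional ℂ (spectralSubspace A (Set.Icc c d)) := by
  intro hfin
  obtain ⟨p, q, hpq, -⟩ := exists_isWindowFamily_isCutoff_Ioi hcd Set.Ioo_subset_Icc_self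
  have exists_ne_zero (k : ℕ) : ∃ v ∈ spectralSubspace A (Set.Icc (p k) (q k)), v ≠ 0 := by
    refine Submodule.exists_mem_ne_zero_of_ne_bot (spectralSubspace_ne_bot hA ?_)
    obtain ⟨r, hr⟩ := Set.nonempty_Ioo.2 (hpq.lt k)
    refine ⟨r, ?_, hspec (hpq.subset k (Set.Ioo_subset_Icc_self hr))⟩
    rwa [interior_Icc]
  choose v hv hv₀ using exists_ne_zero
  have independent : LinearIndependent ℂ v := linearIndependent_of_ne_zero_of_inner_eq_zero hv₀
    fun i j hij => inner_eq_zero_of_mem_spectralSubspace hA isClosed_Icc isClosed_Icc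
      (hpq.disjoint hij) (hv i) (hv j)
  let w (k : ℕ) : spectralSubspace A (Set.Icc c d) :=
    ⟨v k, spectralSubspace_mono A (hpq.subset k) (hv k)⟩
  have independent_w : LinearIndependent ℂ w := .of_comp (Submodule.subtype _) independent
  exact not_finite_iff_infinite.2 inferInstance independent_w.finite

theorem norm_apply_le_of_mem_spectralSubspace (hA : IsSelfAdjoint A) {C : ℝ} (hC : 0 ≤ C)
    (hs : s ⊆ Set.Icc (-C) C) (hx : x ∈ spectralSubspace A s) : ‖A x‖ ≤ C * ‖x‖ := by
  let f (r : ℝ) : ℝ := max (-C) (min C r)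
  have f_eqOn_id : Set.EqOn f id s := fun r hr =>
    (congrArg _ (min_eq_right (hs hr).2)).trans (max_eq_right (hs hr).1)
  have abs_f_le (r : ℝ) : |f r| ≤ C :=
    abs_le.2 ⟨le_max_left _ _, max_le (neg_le_self hC) (min_le_left _ _)⟩
  rw [← cfc_id ℝ A, ← cfc_apply_congr hx (by fun_prop) continuous_id f_eqOn_id]
  exact ContinuousLinearMap.le_of_opNorm_le _ (norm_cfc_le hC fun r _ => abs_f_le r) x

theorem cfc_apply_cfc_apply_of_eqOn_one {f g : ℝ → ℝ} (hA : IsSelfAdjoint A) (hf : Continuous f)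
    (hg : Continuous g) (hfg : Set.EqOn (fun r => f r * g r) 1 s) (hx : x ∈ spectralSubspace A s) :
    cfc f A (cfc g A x) = x := by
  rw [← mul_apply_eq_comp, ← cfc_mul f g A hf.continuousOn hg.continuousOn,
    cfc_apply_congr hx (f := fun r => f r * g r) (hf.mul hg) continuous_one hfg]
  simp only [Pi.one_def, cfc_const_one ℝ A, one_apply_eq_self]

section PositiveLowerBound

variable {c : ℝ}

theorem continuous_inv_max (hc : 0 < c) : Continuous fun r : ℝ => (max c r)⁻¹ :=
  (continuous_const.max continuous_id).inv₀ fun _ => (lt_max_of_lt_left hc).ne'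

theorem inv_max_mul_self (hc : 0 < c) {r : ℝ} (hr : c ≤ r) : (max c r)⁻¹ * r = 1 := by
  rw [max_eq_right hr, inv_mul_cancel₀ (hc.trans_le hr).ne']

theorem mul_norm_le_norm_apply_of_mem_spectralSubspace (hA : IsSelfAdjoint A) (hc : 0 < c)
    (hs : s ⊆ Set.Ici c) (hx : x ∈ spectralSubspace A s) : c * ‖x‖ ≤ ‖A x‖ := by
  have inv_apply : cfc (fun r => (max c r)⁻¹) A (A x) = x := by
    simpa only [cfc_id ℝ A] using cfc_apply_cfc_apply_of_eqOn_one hA (continuous_inv_max hc)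
      continuous_id (fun r hr => inv_max_mul_self hc (hs hr)) hx
  rw [← le_inv_mul_iff₀ hc]
  calc ‖x‖ = ‖cfc (fun r => (max c r)⁻¹) A (A x)‖ := by rw [inv_apply]
    _ ≤ c⁻¹ * ‖A x‖ := ContinuousLinearMap.le_of_opNorm_le _
      (norm_cfc_le (inv_nonneg.2 hc.le) fun r _ => ?_) _
  rw [Real.norm_of_nonneg (inv_nonneg.2 (hc.le.trans (le_max_left c r)))]
  exact inv_anti₀ hc (le_max_left c r)

theorem surjOn_spectralSubspace (hA : IsSelfAdjoint A) (hc : 0 < c) (hs : s ⊆ Set.Ici c) :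
    Set.SurjOn A (spectralSubspace A s) (spectralSubspace A s) := fun x hx =>
  ⟨cfc (fun r => (max c r)⁻¹) A x, cfc_apply_mem_spectralSubspace _ hx, by
    simpa only [cfc_id ℝ A] using cfc_apply_cfc_apply_of_eqOn_one hA continuous_id
      (continuous_inv_max hc) (fun r hr => (mul_comm _ _).trans (inv_max_mul_self hc (hs hr))) hx⟩

end PositiveLowerBound

end SpectralSubspace

section UnitaryShift

theorem infinite_range_pair (k : ℕ) : (Set.range (Nat.pair k)).Infinite :=
  Set.infinite_range_of_injective fun _ _ h => (Nat.pair_eq_pair.1 h).2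

theorem nth_range_pair (k m : ℕ) : Nat.nth (· ∈ Set.range (Nat.pair k)) m = Nat.pair k m := by
  have hk := infinite_range_pair k
  have strictMono_pair : StrictMono (Nat.pair k) := fun _ _ => Nat.pair_lt_pair_right k
  exact congrFun (((Nat.nth_strictMono hk).range_inj strictMono_pair).1
    (Nat.range_nth_of_infinite hk)) m

variable {H ι : Type*} [NormedAddCommGroup H] [InnerProductSpace ℂ H] [CompleteSpace H]

theorem spread_range_pair_apply (e : HilbertBasis ℕ ℂ H) (k l i m : ℕ) :
    spread e (infinite_range_pair k) (infinite_range_pair l) (e (Nat.pair i m)) =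
      if i = k then e (Nat.pair l m) else 0 := by
  split_ifs with hik
  · subst hik
    simpa only [nth_range_pair] using
      spread_apply_nth e (infinite_range_pair i) (infinite_range_pair l) m
  · refine spread_apply_of_notMem _ _ _ ?_
    rintro ⟨m', hm'⟩
    exact hik (Nat.pair_eq_pair.1 hm').1.symm

theorem isUnitarySpread_of_rows_nat (b : HilbertBasis (ℕ × ℕ) ℂ H) (s : ℕ → ℕ) {U : H →L[ℂ] H}
    (hU : U ∈ unitary (H →L[ℂ] H)) (hUb : ∀ k m, U (b (k, m)) = b (s k, m)) :
    IsUnitarySpread U := by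
  let e := reindexHilbertBasis b Nat.pairEquiv.symm
  have e_pair (k m : ℕ) : e (Nat.pair k m) = b (k, m) := by
    rw [reindexHilbertBasis_apply, Nat.pairEquiv_symm_apply, Nat.unpair_pair]
  refine ⟨hU, e, fun k => Set.range (Nat.pair k), fun k => Set.range (Nat.pair (s k)),
    fun k => infinite_range_pair k, fun k => infinite_range_pair (s k), fun x => ?_⟩
  have hx := b.hasSum_repr x
  have hUx := hx.mapL U
  refine (hUx.prod_fiberwise fun k => ?_).tendsto_sum_nat
  have hSx := hx.mapL (spread e (infinite_range_pair k) (infinite_range_pair (s k)))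
  rw [← (Prod.mk_right_injective k).hasSum_iff] at hSx
  · convert hSx using 2 with m
    rw [Function.comp_apply, map_smul, map_smul, hUb, ← e_pair, ← e_pair, spread_range_pair_apply,
      if_pos rfl]
  · rintro ⟨i, m⟩ him
    have hik : i ≠ k := by
      rintro rfl
      exact him ⟨m, rfl⟩
    rw [map_smul, ← e_pair, spread_range_pair_apply, if_neg hik, smul_zero]

theorem isUnitarySpread_permuteHilbertBasis [Denumerable ι] (b : HilbertBasis (ι × ℕ) ℂ H)
    (σ : Equiv.Perm ι) :
    IsUnitarySpread (permuteHilbertBasis b (σ.prodCongr (Equiv.refl ℕ)) : H →L[ℂ] H) := by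
  let τ : ℕ ≃ ι := (Denumerable.eqv ι).symm
  refine isUnitarySpread_of_rows_nat (reindexHilbertBasis b (τ.prodCongr (Equiv.refl ℕ)))
    (fun k => τ.symm (σ (τ k))) (Unitary.linearIsometryEquiv.symm _).2 fun k m => ?_
  simp only [reindexHilbertBasis_apply,
    Equiv.prodCongr_apply, Prod.map_apply, Equiv.apply_symm_apply]
  exact permuteHilbertBasis_apply_self ..

theorem exists_isUnitarySpread_isShift [TopologicalSpace.SeparableSpace H]
    {K : ℤ → Submodule ℂ H} [∀ n, CompleteSpace (K n)]
    (hK : IsHilbertSum ℂ (fun n => K n) fun n => (K n).subtypeₗᵢ)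
    (hdim : ∀ n, ¬ FiniteDimensional ℂ (K n)) :
    ∃ U : H ≃ₗᵢ[ℂ] H, IsUnitarySpread (U : H →L[ℂ] H) ∧ IsShift (U : H →L[ℂ] H) K := by
  let b (n : ℤ) : HilbertBasis ℕ ℂ (K n) := (nonempty_hilbertBasis_nat (hdim n)).some
  obtain ⟨e, he⟩ := exists_hilbertBasis_prod hK b
  let U := permuteHilbertBasis e ((Equiv.addRight (1 : ℤ)).prodCongr (Equiv.refl ℕ))
  have U_apply (n : ℤ) (m : ℕ) : U (b n m) = b (n + 1) m := by
    rw [← he, permuteHilbertBasis_apply_self, ← he]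
    rfl
  refine ⟨U, isUnitarySpread_permuteHilbertBasis e _, hK, fun n x hx => ?_⟩
  have hUx := ((b n).hasSum_repr ⟨x, hx⟩).mapL ((U : H →L[ℂ] H) ∘L (K n).subtypeL)
  have isClosed_succ : IsClosed (K (n + 1) : Set H) :=
    (completeSpace_coe_iff_isComplete.1 inferInstance).isClosed
  refine isClosed_succ.mem_of_tendsto hUx (.of_forall fun F => Submodule.sum_mem _ fun m _ => ?_)
  rw [map_smul]
  refine (K (n + 1)).smul_mem _ ?_
  change U (b n m) ∈ K (n + 1)
  exact U_apply n m ▸ (b (n + 1) m).2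

end UnitaryShift

section PointSpectrum

variable {H : Type*} [NormedAddCommGroup H] [InnerProductSpace ℂ H] {T : H →L[ℂ] H}

theorem mem_pointSpectrum {μ : ℂ} : μ ∈ pointSpectrum T ↔ ∃ x ≠ 0, T x = μ • x := by
  refine ⟨fun h => ?_, fun ⟨x, hx₀, hx⟩ =>
    Module.End.hasEigenvalue_of_hasEigenvector ⟨Module.End.mem_eigenspace_iff.2 hx, hx₀⟩⟩
  obtain ⟨x, hx⟩ := Module.End.HasEigenvalue.exists_hasEigenvector h
  exact ⟨x, hx.2, hx.apply_eq_smul⟩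

theorem injective_of_pointSpectrum_eq_empty (hT : pointSpectrum T = ∅) : Function.Injective T :=
  (injective_iff_map_eq_zero T).2 fun x hx => by_contra fun hx₀ =>
    Set.eq_empty_iff_forall_notMem.1 hT 0 (mem_pointSpectrum.2 ⟨x, hx₀, by rw [hx, zero_smul]⟩)

end PointSpectrum

section UnitaryTimesSelfAdjoint

variable {H : Type*} [NormedAddCommGroup H] [InnerProductSpace ℂ H] [CompleteSpace H]
  {A : H →L[ℂ] H} {p q : ℤ → ℝ}

theorem exists_isUnitarySpread_isShift_of_isWindowFamily [TopologicalSpace.SeparableSpace H]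
    (hA : IsSelfAdjoint A) (hpq : IsWindowFamily p q (spectrum ℝ A)) :
    ∃ (U : H ≃ₗᵢ[ℂ] H) (K : ℤ → Submodule ℂ H), IsUnitarySpread (U : H →L[ℂ] H) ∧
      IsShift (U : H →L[ℂ] H) K ∧ (∀ n, IsClosed (K n : Set H)) ∧ K 0 ≠ ⊥ ∧
      (∀ n, ∀ x ∈ K n, A x ∈ K n) ∧
      ∀ n ≠ 0, K n = spectralSubspace A (Set.Icc (p n) (q n)) := by
  let E (n : ℤ) : Submodule ℂ H := spectralSubspace A (Set.Icc (p n) (q n))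
  have isClosed_E (n : ℤ) : IsClosed (E n : Set H) := isClosed_spectralSubspace A _
  have isOrtho_E : Pairwise fun m n => E m ⟂ E n := fun m n hmn =>
    Submodule.isOrtho_iff_inner_eq.2 fun x hx y hy =>
      inner_eq_zero_of_mem_spectralSubspace hA isClosed_Icc isClosed_Icc (hpq.disjoint hmn) hx hy
  have apply_mem_E (n : ℤ) (x : H) (hx : x ∈ E n) : A x ∈ E n := apply_mem_spectralSubspace hA hx
  let K := completedFamily E 0
  have isClosed_K := isClosed_completedFamily (i₀ := 0) isClosed_E
  have infinite_K (n : ℤ) : ¬ FiniteDimensional ℂ (K n) := fun _ =>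
    not_finiteDimensional_spectralSubspace hA (hpq.lt n) (hpq.subset n)
      (Submodule.finiteDimensional_of_le (le_completedFamily (i₀ := 0) isOrtho_E n))
  have (n : ℤ) : CompleteSpace (K n) := (isClosed_K n).completeSpace_coe
  obtain ⟨U, hU, hUK⟩ := exists_isUnitarySpread_isShift
    (isHilbertSum_completedFamily (i₀ := 0) isClosed_E isOrtho_E) infinite_K
  refine ⟨U, K, hU, hUK, isClosed_K, fun h => infinite_K 0 (h ▸ inferInstance),
    fun n x => apply_mem_completedFamily hA apply_mem_E n, fun n => completedFamily_of_ne⟩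

theorem pointSpectrum_comp_eq_setOf (hA : IsSelfAdjoint A) (hinj : Function.Injective A)
    {K : ℤ → Submodule ℂ H} {U : H ≃ₗᵢ[ℂ] H} (hU : IsShift (U : H →L[ℂ] H) K)
    (hcl : ∀ n, IsClosed (K n : Set H)) (hK₀ : K 0 ≠ ⊥) (hAK : ∀ n, ∀ x ∈ K n, A x ∈ K n)
    (hK : ∀ n ≠ 0, K n = spectralSubspace A (Set.Icc (p n) (q n))) (hp : ∀ n, 0 < p n)
    (hpq : ∀ n, p n ≤ q n) {S₁ S₂ : Set ℝ} (h₁ : IsCutoff (fun k => p k) (fun k => q k) S₁)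
    (h₂ : IsCutoff (fun k => (q (-(k + 1)))⁻¹) (fun k => (p (-(k + 1)))⁻¹) S₂)
    (hS₁ : S₁ ⊆ Set.Ioi 0) :
    pointSpectrum ((U : H →L[ℂ] H) ∘L A) = {z | ‖z‖ ∈ S₁ ∧ ‖z‖⁻¹ ∈ S₂} := by
  have (n : ℤ) : CompleteSpace (K n) := (hcl n).completeSpace_coe
  have hT := hU.comp hAK
  have norm_apply (x : H) : ‖((U : H →L[ℂ] H) ∘L A) x‖ = ‖A x‖ := U.norm_map (A x)
  have mul_norm_le (n : ℤ) (hn : n ≠ 0) (x : H) (hx : x ∈ K n) :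
      p n * ‖x‖ ≤ ‖((U : H →L[ℂ] H) ∘L A) x‖ := norm_apply x ▸
    mul_norm_le_norm_apply_of_mem_spectralSubspace hA (hp n) Set.Icc_subset_Ici_self (hK n hn ▸ hx)
  have norm_le_mul (n : ℤ) (hn : n ≠ 0) (x : H) (hx : x ∈ K n) :
      ‖((U : H →L[ℂ] H) ∘L A) x‖ ≤ q n * ‖x‖ := norm_apply x ▸
    norm_apply_le_of_mem_spectralSubspace hA ((hp n).le.trans (hpq n))
      (Set.Icc_subset_Icc_left (by linarith [hp n, hpq n])) (hK n hn ▸ hx)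
  have surjOn (n : ℤ) (hn : n < 0) : Set.SurjOn ((U : H →L[ℂ] H) ∘L A) (K n) (K (n + 1)) := by
    refine (hU.surjOn U.bijective n).comp ?_
    rw [hK n hn.ne]
    exact surjOn_spectralSubspace hA (hp n) Set.Icc_subset_Ici_self
  ext μ
  rw [mem_pointSpectrum]
  refine ⟨fun ⟨x, hx₀, hx⟩ => ?_, fun ⟨hμ₁, hμ₂⟩ => ?_⟩
  · exact hT.norm_mem_of_apply_eq_smul (U.injective.comp hinj)
      (fun n _ => (hp n).trans_le (hpq n)) mul_norm_le norm_le_mul h₁ h₂ hx₀ hx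
  · exact hT.exists_apply_eq_smul_of_isCutoff hK₀ surjOn (fun n _ => hp n) mul_norm_le norm_le_mul
      h₁ h₂ (norm_pos_iff.1 (hS₁ hμ₁)) hμ₁ hμ₂

end UnitaryTimesSelfAdjoint

theorem mainTheorem3_general {H : Type*} [NormedAddCommGroup H] [InnerProductSpace ℂ H]
    [CompleteSpace H] [TopologicalSpace.SeparableSpace H] (A : H →L[ℂ] H) (hA : IsSelfAdjoint A)
    (hinj : Function.Injective A) (R : Set ℂ) (hR : IsAnnularRing R)
    (hRsub : ∀ z ∈ R, ‖z‖ ∈ interior (spectrum ℝ A)) :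
    ∃ U : H →L[ℂ] H, IsUnitarySpread U ∧ pointSpectrum (U ∘L A) = R := by
  obtain ⟨p, q, S₁, S₂, hpq, h₁, h₂, hS₁, rfl⟩ := exists_isWindowFamily_of_isAnnularRing hR hRsub
  obtain ⟨U, K, hU, hUK, hcl, hK₀, hAK, hK⟩ :=
    exists_isUnitarySpread_isShift_of_isWindowFamily hA (hpq.mono Set.inter_subset_right)
  exact ⟨U, hU, pointSpectrum_comp_eq_setOf hA hinj hUK hcl hK₀ hAK hK
    (fun n => (hpq.subset n (Set.left_mem_Icc.2 (hpq.lt n).le)).1) (fun n => (hpq.lt n).le)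
    h₁ h₂ hS₁⟩

theorem mainTheorem3 {H : Type*} [NormedAddCommGroup H] [InnerProductSpace ℂ H] [CompleteSpace H]
    [TopologicalSpace.SeparableSpace H] (A : H →L[ℂ] H) (hA : IsSelfAdjoint A)
    (l₁ l₂ : ℝ) (hl₁ : 0 < l₁) (hl : l₁ < l₂)
    (hspec : spectrum ℂ A = (fun t : ℝ => (t : ℂ)) '' Set.Icc l₁ l₂)
    (hpoint : pointSpectrum A = ∅)
    (R : Set ℂ) (hR : IsAnnularRing R) (hRsub : R ⊆ {z : ℂ | l₁ < ‖z‖ ∧ ‖z‖ < l₂}) :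
    ∃ U : H →L[ℂ] H, IsUnitarySpread U ∧ pointSpectrum (U ∘L A) = R := by
  have spectrum_real : spectrum ℝ A = Set.Icc l₁ l₂ := by
    rw [← spectrum.preimage_algebraMap ℂ, hspec]
    exact Set.preimage_image_eq _ Complex.ofReal_injective
  refine mainTheorem3_general A hA (injective_of_pointSpectrum_eq_empty hpoint) R hR fun z hz => ?_
  rw [spectrum_real, interior_Icc]
  exact hRsub hz
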